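/- Let $n\ge 1$ and equip $\mathbb{C}^n$ with the Euclidean norm. A domain is a nonempty connected open set. Let $D\subset\mathbb{C}^n$ be a Reinhardt domain, i.e. a domain such that $(\lambda_1z_1,\dots,\lambda_nz_n)\in D$ whenever $z\in D$ and $|\lambda_1|=\dots=|\lambda_n|=1$, and let $d_D(z)$ be the Euclidean distance of $z\in D$ to $\partial D$. Assume that $D$ is pseudoconvex, i.e. that $-\log d_D$ is plurisubharmonic on $D$ (if $D=\mathbb{C}^n$, pseudoconvexity holds by convention). Let $\mathbb{D}\subset\mathbb{C}$ be the unit disc with the Poincaré distance $p(\lambda,\mu)=\frac12\log\frac{1+m}{1-m}$, $m=\left|\frac{\lambda-\mu}{1-\overline{\lambda}\mu}\right|$. For a domain $G$ in some $\mathbb{C}^m$ and $w,z\in G$ let $$\widetilde k_G(w,z)=\inf\{p(\lambda,\mu):\lambda,\mu\in\mathbb{D},\ \exists f:\mathbb{D}\to G\text{ holomorphic with } f(\lambda)=w,\ f(\mu)=z\}$$ be the Lempert function of $G$. The Kobayashi pseudodistance is $k_G(w,z)=\sup d_G(w,z)$, where the supremum is over all families $(d_G)_G$, indexed by all domains $G$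 in all $\mathbb{C}^m$, of pseudodistances $d_G$ on $G$ that are not increased by holomorphic maps between domains and satisfy $d_G\le\widetilde k_G$. Fix $z_0\in D$ and $\zeta_0\in\partial D\cap\operatorname{int}\overline{D}$. Then there exist a constant $C\in\mathbb{R}$ and a neighbourhood $U$ of $\zeta_0$ such that $$k_D(z_0,z)\le\tfrac12\log\bigl(-\log d_D(z)\bigr)+C\qquad\text{for all } z\in D\cap U.$$ -/

import Mathlib

open Set Filter Topology
open scoped ENNReal ComplexConjugate

noncomputable section

namespace KobReinhardt

/-- Complex `n`-space with its Euclidean (Hermitian) norm. -/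
abbrev Cn (n : ℕ) : Type := EuclideanSpace ℂ (Fin n)

/-- A domain: a nonempty connected open set. -/
def IsDomainSet {n : ℕ} (D : Set (Cn n)) : Prop := IsOpen D ∧ IsConnected D

/-- A set invariant under `z ↦ (t₁ z₁, …, tₙ zₙ)` for all unimodular `t₁, …, tₙ`. -/
def IsReinhardt {n : ℕ} (D : Set (Cn n)) : Prop :=
  ∀ t : Fin n → ℂ, (∀ j, ‖t j‖ = 1) → ∀ z ∈ D, WithLp.toLp 2 (fun j => t j * z j) ∈ D

/-- Plurisubharmonicity of a real-valued (hence nowhere `-∞`) function on an open set `D`: upper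
semicontinuity, and the sub-mean value inequality on every closed affine complex disc in `D`. A
finite plurisubharmonic function is automatically integrable over the boundary circles. -/
def IsPSHOn {n : ℕ} (u : Cn n → ℝ) (D : Set (Cn n)) : Prop :=
  UpperSemicontinuousOn u D ∧
    ∀ z ∈ D, ∀ w : Cn n, (∀ t : ℂ, ‖t‖ ≤ 1 → z + t • w ∈ D) →
      CircleIntegrable (fun t : ℂ => u (z + t • w)) 0 1 ∧
        u z ≤ Real.circleAverage (fun t : ℂ => u (z + t • w)) 0 1

/-- The Euclidean distance from `z` to the boundary of `D`. (For `D` the whole space the boundary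
is empty and the value is `0`.) -/
def bdryDist {n : ℕ} (D : Set (Cn n)) (z : Cn n) : ℝ := Metric.infDist z (frontier D)

/-- Pseudoconvexity of an open set `D`: the function `-log d_D` is plurisubharmonic on `D`.
(For `D` the whole space the function below is constant, so the whole space is pseudoconvex.) -/
def IsPseudoconvex {n : ℕ} (D : Set (Cn n)) : Prop :=
  IsPSHOn (fun z => -Real.log (bdryDist D z)) D

/-- The Poincaré distance of the unit disc (of curvature `-4`):
`p(a, b) = (1/2) log ((1 + m) / (1 - m))` with `m = |(a - b) / (1 - conj a * b)|`. -/
def poincareDist (a b : ℂ) : ℝ :=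
  (1 / 2) * Real.log
    ((1 + ‖(a - b) / (1 - conj a * b)‖) / (1 - ‖(a - b) / (1 - conj a * b)‖))

/-- The Lempert function of `D`; the infimum is `⊤` if no analytic disc joins the points. -/
def lempert {n : ℕ} (D : Set (Cn n)) (w z : Cn n) : ℝ≥0∞ :=
  ⨅ (f : ℂ → Cn n) (a : ℂ) (b : ℂ)
    (_ : DifferentiableOn ℂ f (Metric.ball 0 1) ∧ MapsTo f (Metric.ball 0 1) D ∧
      a ∈ Metric.ball (0 : ℂ) 1 ∧ b ∈ Metric.ball (0 : ℂ) 1 ∧ f a = w ∧ f b = z),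
    ENNReal.ofReal (poincareDist a b)

/-- A choice, for every `n` and every set `D` in `ℂⁿ`, of a real function of two points; only the
values at domains `D` and at points of `D` matter. -/
abbrev DistFamily : Type := ∀ n : ℕ, Set (Cn n) → Cn n → Cn n → ℝ

/-- `d` restricts to a pseudodistance on `D`. -/
structure IsPseudodistOn {n : ℕ} (D : Set (Cn n)) (d : Cn n → Cn n → ℝ) : Prop where
  nonneg : ∀ w ∈ D, ∀ z ∈ D, 0 ≤ d w z
  self : ∀ z ∈ D, d z z = 0
  symm : ∀ w ∈ D, ∀ z ∈ D, d w z = d z w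
  triangle : ∀ w ∈ D, ∀ x ∈ D, ∀ z ∈ D, d w z ≤ d w x + d x z

/-- Holomorphically invariant families of pseudodistances (holomorphic maps between domains do not
increase them) which are less than or equal to the Lempert function. -/
structure IsAdmissible (d : DistFamily) : Prop where
  pseudodist : ∀ (n : ℕ) (D : Set (Cn n)), IsDomainSet D → IsPseudodistOn D (d n D)
  contract : ∀ (m n : ℕ) (G : Set (Cn m)) (D : Set (Cn n)), IsDomainSet G → IsDomainSet D →
    ∀ f : Cn m → Cn n, DifferentiableOn ℂ f G → MapsTo f G D →
      ∀ w ∈ G, ∀ z ∈ G, d n D (f w) (f z) ≤ d m G w z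
  le_lempert : ∀ (n : ℕ) (D : Set (Cn n)), IsDomainSet D →
    ∀ w ∈ D, ∀ z ∈ D, ENNReal.ofReal (d n D w z) ≤ lempert D w z

/-- The Kobayashi (pseudo)distance of the domain `D`. -/
def kobayashi {n : ℕ} (D : Set (Cn n)) (w z : Cn n) : ℝ≥0∞ :=
  ⨆ (d : DistFamily) (_ : IsAdmissible d), ENNReal.ofReal (d n D w z)

end KobReinhardt

end

noncomputable section

namespace KobReinhardt

variable {n : ℕ} {D : Set (Cn n)}

/-! Near `ζ₀` the domain contains a polydisc with some coordinate hyperplanes removed, and the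
factor 1/2 together with the iterated logarithm comes from the Poincaré distance of a punctured
disc.

The structural half rests on logarithmic convexity. A Reinhardt domain is described by the
logarithms of the moduli of its points. Testing plurisubharmonicity of `-log d_D` on affine discs
tangent to a real logarithmic direction shows that it obeys a maximum principle on segments of the
logarithmic image (`not_eventually_le_concave`, `le_bdryDist_of_mem_segment`). Hence the logarithmic
image and the sets where `d_D` is bounded below are convex there (`convex_logDomain`,
`convex_logSublevel`). An open convex set is the interior of its closure, which settles points with
nonzero coordinates. Points with zero coordinates are reached along rays on which `d_D` stays
bounded below, and such rays exist when `D` meets the hyperplanes concerned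
(`mem_of_mem_interior_closure`). So `ζ₀` can fail to lie in `D` only because it lies on hyperplanes
`z j = 0` disjoint from `D`.

The metric half joins `z` to a fixed compact polyannulus by one exponential disc in all the
punctured coordinates at once, at cost `(1/2) log X`, where `X` is the largest value of `log (ρ / |z
j|)`. As `d_D(z)` is at most the distance to a missing hyperplane, `X ≤ -log d_D(z)`. The rest of
the way to `z₀` is uniformly bounded by compactness. -/

/-! ### Rotations and the boundary distance. -/

/-- The coordinatewise rotation of `ℂⁿ` by unimodular numbers. -/
def rotate (t : Fin n → Circle) : Cn n ≃ₗᵢ[ℝ] Cn n :=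
  LinearIsometryEquiv.piLpCongrRight 2 fun j => rotation (t j)

@[simp] lemma rotate_apply (t : Fin n → Circle) (z : Cn n) (j : Fin n) :
    rotate t z j = (t j : ℂ) * z j := rfl

lemma IsReinhardt.rotate_mem (hR : IsReinhardt D) (t : Fin n → Circle) {z : Cn n} (hz : z ∈ D) :
    rotate t z ∈ D := by
  exact hR (fun j => (t j : ℂ)) (fun j => Circle.norm_coe (t j)) z hz

lemma rotate_inv_rotate (t : Fin n → Circle) (z : Cn n) : rotate t⁻¹ (rotate t z) = z := by
  ext j; simp

lemma IsReinhardt.rotate_mem_iff (hR : IsReinhardt D) (t : Fin n → Circle) {z : Cn n} :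
    rotate t z ∈ D ↔ z ∈ D := by
  refine ⟨fun h => ?_, hR.rotate_mem t⟩
  simpa [rotate_inv_rotate] using hR.rotate_mem t⁻¹ h

lemma IsReinhardt.preimage_rotate (hR : IsReinhardt D) (t : Fin n → Circle) :
    rotate t ⁻¹' D = D := Set.ext fun _ => hR.rotate_mem_iff t

lemma IsReinhardt.bdryDist_rotate (hR : IsReinhardt D) (t : Fin n → Circle) (z : Cn n) :
    bdryDist D (rotate t z) = bdryDist D z := by
  have h : rotate t '' frontier D = frontier D := by
    have := (rotate t).toHomeomorph.preimage_frontier D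
    rw [show (rotate t).toHomeomorph ⁻¹' D = D from hR.preimage_rotate t] at this
    conv_lhs => rw [← this]
    exact (rotate t).toHomeomorph.surjective.image_preimage _
  unfold bdryDist
  conv_lhs => rw [← h]
  exact Metric.infDist_image (rotate t).isometry

lemma exists_rotate_of_norm_eq {z w : Cn n} (h : ∀ j, ‖z j‖ = ‖w j‖) :
    ∃ t : Fin n → Circle, rotate t z = w := by
  have : ∀ j, ∃ s : Circle, (s : ℂ) * z j = w j := by
    intro j
    by_cases hz : z j = 0
    · refine ⟨1, ?_⟩
      have : ‖w j‖ = 0 := by rw [← h j, hz, norm_zero]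
      simp [hz, norm_eq_zero.1 this]
    · have hw : ‖w j / z j‖ = 1 := by
        rw [norm_div, ← h j, div_self (norm_ne_zero_iff.2 hz)]
      exact ⟨⟨w j / z j, by simpa [Submonoid.unitSphere] using hw⟩, div_mul_cancel₀ _ hz⟩
  choose t ht using this
  exact ⟨t, by ext j; simp [ht]⟩

lemma IsReinhardt.mem_iff_of_norm_eq (hR : IsReinhardt D) {z w : Cn n}
    (h : ∀ j, ‖z j‖ = ‖w j‖) : z ∈ D ↔ w ∈ D := by
  obtain ⟨t, rfl⟩ := exists_rotate_of_norm_eq h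
  exact (hR.rotate_mem_iff t).symm

lemma IsReinhardt.bdryDist_eq_of_norm_eq (hR : IsReinhardt D) {z w : Cn n}
    (h : ∀ j, ‖z j‖ = ‖w j‖) : bdryDist D z = bdryDist D w := by
  obtain ⟨t, rfl⟩ := exists_rotate_of_norm_eq h
  exact (hR.bdryDist_rotate t z).symm

lemma continuous_bdryDist (D : Set (Cn n)) : Continuous (bdryDist D) :=
  Metric.continuous_infDist_pt _

lemma bdryDist_pos (hD : IsOpen D) (hf : (frontier D).Nonempty) {z : Cn n} (hz : z ∈ D) :
    0 < bdryDist D z := by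
  refine (isClosed_frontier.notMem_iff_infDist_pos hf).1 fun h => ?_
  rw [hD.frontier_eq] at h
  exact h.2 hz

/-- Closes the limit arguments below: a positive lower bound for the boundary distance survives
limits by continuity, and so keeps the limit point inside `D`. -/
lemma mem_of_mem_closure_of_bdryDist_pos {z : Cn n} (hz : z ∈ closure D)
    (h : 0 < bdryDist D z) : z ∈ D := by
  by_contra hn
  have hzf : z ∈ frontier D := ⟨hz, fun h' => hn (interior_subset h')⟩
  exact h.ne' (Metric.infDist_zero_of_mem hzf)

/-- The boundary distance is at most the distance to any point outside `D`. -/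
lemma bdryDist_le_dist (hD : IsOpen D) {z w : Cn n} (hz : z ∈ D) (hw : w ∉ D) :
    bdryDist D z ≤ dist z w := by
  obtain ⟨x, hx, hxf⟩ : ∃ x ∈ segment ℝ z w, x ∈ frontier D := by
    by_contra! hno
    obtain ⟨x, -, hx, hx'⟩ := (convex_segment z w).isPreconnected D (closure D)ᶜ hD
      isClosed_closure.isOpen_compl (fun x hx => by
        by_contra hx'
        simp only [mem_union, mem_compl_iff, not_or, not_not] at hx'
        exact hno x hx (by rw [hD.frontier_eq]; exact ⟨hx'.2, hx'.1⟩))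
      ⟨z, left_mem_segment ℝ z w, hz⟩ ⟨w, right_mem_segment ℝ z w, fun hc =>
        hno w (right_mem_segment ℝ z w) (by rw [hD.frontier_eq]; exact ⟨hc, hw⟩)⟩
    exact hx' (subset_closure hx)
  refine (Metric.infDist_le_dist_of_mem hxf).trans ?_
  have := dist_add_dist_of_mem_segment hx
  linarith [dist_nonneg (x := x) (y := w)]

/-! ### Logarithmic coordinates. -/

/-- The point with coordinates `exp (x j)`. -/
def expPt (x : EuclideanSpace ℝ (Fin n)) : Cn n := WithLp.toLp 2 fun j => (Real.exp (x j) : ℂ)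

@[simp] lemma expPt_apply (x : EuclideanSpace ℝ (Fin n)) (j : Fin n) :
    expPt x j = (Real.exp (x j) : ℂ) := rfl

lemma norm_expPt_apply (x : EuclideanSpace ℝ (Fin n)) (j : Fin n) :
    ‖expPt x j‖ = Real.exp (x j) := by
  rw [expPt_apply, Complex.norm_real, Real.norm_eq_abs, abs_of_pos (Real.exp_pos _)]

lemma continuous_expPt : Continuous (expPt (n := n)) := by
  unfold expPt
  fun_prop

/-- The logarithmic image of a Reinhardt domain. -/
def logDomain (D : Set (Cn n)) : Set (EuclideanSpace ℝ (Fin n)) := expPt ⁻¹' D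

lemma isOpen_logDomain (hD : IsOpen D) : IsOpen (logDomain D) := hD.preimage continuous_expPt

/-- The points of the logarithmic image where the boundary distance is at least `c`. -/
def logSublevel (D : Set (Cn n)) (c : ℝ) : Set (EuclideanSpace ℝ (Fin n)) :=
  {x | expPt x ∈ D ∧ c ≤ bdryDist D (expPt x)}

/-- The moduli of the coordinates along an affine disc through `expPt x`, in logarithmic
coordinates. -/
lemma norm_expPt_add_smul {x e : EuclideanSpace ℝ (Fin n)} {t : ℂ} (j : Fin n)
    (h : 1 + t * e j ≠ 0) :
    ‖(expPt x + t • (WithLp.toLp 2 fun j => expPt x j * (e j : ℂ) : Cn n)) j‖ =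
      ‖expPt (x + WithLp.toLp 2 fun j => Real.log ‖1 + t * (e j : ℂ)‖) j‖ := by
  rw [norm_expPt_apply]
  have : (expPt x + t • (WithLp.toLp 2 fun j => expPt x j * (e j : ℂ) : Cn n)) j
      = expPt x j * (1 + t * e j) := by simp; ring
  rw [this, norm_mul, norm_expPt_apply]
  simp only [PiLp.add_apply]
  rw [Real.exp_add, Real.exp_log (norm_pos_iff.2 h)]


/-! ### The sub-mean value inequality in logarithmic coordinates. -/

/-- The mean value property of the real part of a holomorphic function. -/
lemma circleAverage_re {H : ℂ → ℂ} (hH : DiffContOnCl ℂ H (Metric.ball 0 1)) :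
    CircleIntegrable (fun s => (H s).re) 0 1 ∧
      Real.circleAverage (fun s => (H s).re) 0 1 = (H 0).re := by
  have hc : ContinuousOn H (Metric.sphere 0 1) := by
    refine hH.continuousOn_ball.mono Metric.sphere_subset_closedBall
  have hi : CircleIntegrable H 0 1 := hc.circleIntegrable zero_le_one
  have hi' : CircleIntegrable (fun s => (H s).re) 0 1 :=
    (Complex.continuous_re.comp_continuousOn hc).circleIntegrable zero_le_one
  refine ⟨hi', ?_⟩
  have h : Real.circleAverage H 0 1 = H 0 := DiffContOnCl.circleAverage (by simpa using hH)
  rw [← h, Real.circleAverage_def, Real.circleAverage_def, Complex.smul_re]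
  congr 1
  exact intervalIntegral.intervalIntegral_re hi

/-- Logarithmic coordinates of the affine disc `t ↦ 1 + t e`. -/
def logDisc (e : EuclideanSpace ℝ (Fin n)) (t : ℂ) : EuclideanSpace ℝ (Fin n) :=
  WithLp.toLp 2 fun j => Real.log ‖1 + t * (e j : ℂ)‖

lemma norm_le_mul_of_forall_abs_le {x y : EuclideanSpace ℝ (Fin n)} {c : ℝ} (hc : 0 ≤ c)
    (h : ∀ j, |x j| ≤ c * |y j|) : ‖x‖ ≤ c * ‖y‖ := by
  rw [← abs_of_nonneg hc, ← Real.norm_eq_abs, ← norm_smul, EuclideanSpace.norm_eq,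
    EuclideanSpace.norm_eq]
  refine Real.sqrt_le_sqrt (Finset.sum_le_sum fun j _ => ?_)
  refine pow_le_pow_left₀ (norm_nonneg _) ?_ 2
  simpa [abs_mul, abs_of_nonneg hc] using h j

lemma abs_coord_le_norm (e : EuclideanSpace ℝ (Fin n)) (j : Fin n) : |e j| ≤ ‖e‖ := by
  simpa using PiLp.norm_apply_le e j

lemma norm_mul_coord_le {e : EuclideanSpace ℝ (Fin n)} (he : ‖e‖ = 1) {t : ℂ} (ht : ‖t‖ ≤ 1 / 2)
    (j : Fin n) : ‖t * (e j : ℂ)‖ ≤ 1 / 2 := by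
  have := (abs_coord_le_norm e j).trans_eq he
  rw [norm_mul, Complex.norm_real, Real.norm_eq_abs]
  nlinarith [norm_nonneg t, abs_nonneg (e j)]

lemma one_add_mem_slitPlane {u : ℂ} (hu : ‖u‖ ≤ 1 / 2) : 1 + u ∈ Complex.slitPlane :=
  Complex.mem_slitPlane_of_norm_lt_one (by linarith)

/-- The logarithmic disc is tangent to the line spanned by `e`. -/
lemma norm_logDisc_sub_le {e : EuclideanSpace ℝ (Fin n)} (he : ‖e‖ = 1) {t : ℂ}
    (ht : ‖t‖ ≤ 1 / 2) : ‖logDisc e t - t.re • e‖ ≤ ‖t‖ ^ 2 := by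
  rw [← mul_one (‖t‖ ^ 2), ← he]
  refine norm_le_mul_of_forall_abs_le (by positivity) fun j => ?_
  have hu := norm_mul_coord_le he ht j
  have h1 := Complex.norm_log_one_add_sub_self_le (z := t * (e j : ℂ)) (by linarith)
  have h2 := (Complex.abs_re_le_norm _).trans h1
  have h3 : (Complex.log (1 + t * (e j : ℂ)) - t * (e j : ℂ)).re = (logDisc e t - t.re • e) j := by
    simp [logDisc, Complex.log_re]
  rw [h3] at h2
  refine h2.trans ?_
  have h4 : (1 - ‖t * (e j : ℂ)‖)⁻¹ ≤ 2 := by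
    rw [inv_le_comm₀ (by linarith) (by norm_num)]
    linarith
  have h5 : ‖t * (e j : ℂ)‖ ^ 2 ≤ ‖t‖ ^ 2 * |e j| := by
    rw [norm_mul, Complex.norm_real, Real.norm_eq_abs, mul_pow]
    have := (abs_coord_le_norm e j).trans_eq he
    gcongr
    nlinarith [abs_nonneg (e j)]
  nlinarith [sq_nonneg ‖t * (e j : ℂ)‖]

lemma expPt_add_smul_mem_iff (hR : IsReinhardt D) {x e : EuclideanSpace ℝ (Fin n)} (he : ‖e‖ = 1)
    {t : ℂ} (ht : ‖t‖ ≤ 1 / 2) :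
    expPt x + t • (WithLp.toLp 2 fun j => expPt x j * (e j : ℂ) : Cn n) ∈ D ↔
      expPt (x + logDisc e t) ∈ D :=
  hR.mem_iff_of_norm_eq fun j => norm_expPt_add_smul j
    (Complex.slitPlane_ne_zero (one_add_mem_slitPlane (norm_mul_coord_le he ht j)))

lemma bdryDist_expPt_add_smul (hR : IsReinhardt D) {x e : EuclideanSpace ℝ (Fin n)} (he : ‖e‖ = 1)
    {t : ℂ} (ht : ‖t‖ ≤ 1 / 2) :
    bdryDist D (expPt x + t • (WithLp.toLp 2 fun j => expPt x j * (e j : ℂ) : Cn n)) =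
      bdryDist D (expPt (x + logDisc e t)) :=
  hR.bdryDist_eq_of_norm_eq fun j => norm_expPt_add_smul j
    (Complex.slitPlane_ne_zero (one_add_mem_slitPlane (norm_mul_coord_le he ht j)))

/-- In logarithmic coordinates, `-log d_D` is not touched from above by a quadratic polynomial
which is strictly concave in some direction. -/
lemma not_eventually_le_concave (hD : IsOpen D) (hR : IsReinhardt D) (hP : IsPseudoconvex D)
    {x e b : EuclideanSpace ℝ (Fin n)} (he : ‖e‖ = 1) (hx : expPt x ∈ D) {η M : ℝ} (hη : 0 < η)
    (hM : 0 < M) :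
    ¬ ∀ᶠ ξ in 𝓝 (0 : EuclideanSpace ℝ (Fin n)),
      -Real.log (bdryDist D (expPt (x + ξ))) ≤ -Real.log (bdryDist D (expPt x)) + inner ℝ b ξ +
        M * (‖ξ‖ ^ 2 - inner ℝ e ξ ^ 2) - η * inner ℝ e ξ ^ 2 := by
  intro hev
  have hmem : ∀ᶠ ξ in 𝓝 (0 : EuclideanSpace ℝ (Fin n)), expPt (x + ξ) ∈ D := by
    have : ContinuousAt (fun ξ => expPt (x + ξ)) 0 :=
      (continuous_expPt.comp (continuous_const.add continuous_id)).continuousAt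
    exact this.eventually_mem (hD.mem_nhds (by simpa using hx))
  obtain ⟨R, hR0, hball⟩ := Metric.eventually_nhds_iff.1 (hev.and hmem)
  -- On the circle of radius `ε` the concave term gains order `ε ^ 2`, while the deviation of the
  -- logarithmic disc from its tangent line costs only `(M + η) * ε ^ 4`. The last condition makes
  -- the gain win; `2 * ε < R` suffices since the deviation is at most `ε ^ 2 ≤ ε`.
  obtain ⟨ε, hε, hε2, hεR, hεη⟩ : ∃ ε > 0, ε ≤ 1 / 2 ∧ 2 * ε < R ∧ ε ^ 2 * (M + η) < η / 4 := by
    have h1 : ∀ᶠ ε in 𝓝 (0 : ℝ), 2 * ε < R :=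
      (by fun_prop : Continuous fun ε : ℝ => 2 * ε).continuousAt.eventually_lt
        continuousAt_const (by simpa using hR0)
    have h2 : ∀ᶠ ε in 𝓝 (0 : ℝ), ε ^ 2 * (M + η) < η / 4 :=
      (by fun_prop : Continuous fun ε : ℝ => ε ^ 2 * (M + η)).continuousAt.eventually_lt
        continuousAt_const (by simpa using hη)
    have h3 : ∀ᶠ ε in 𝓝 (0 : ℝ), ε ≤ 1 / 2 := eventually_le_nhds (by norm_num)
    obtain ⟨ε, ⟨⟨h1, h2⟩, h3⟩, h4⟩ := ((((h1.and h2).and h3).filter_mono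
      nhdsWithin_le_nhds).and (self_mem_nhdsWithin (s := Ioi (0 : ℝ)) (a := 0))).exists
    exact ⟨ε, h4, h3, h1, h2⟩
  have hsmall : ∀ s : ℂ, ‖s‖ ≤ 1 → ‖(ε : ℂ) * s‖ ≤ ε := fun s hs => by
    rw [norm_mul, Complex.norm_real, Real.norm_eq_abs, abs_of_pos hε]
    nlinarith
  have hξ : ∀ t : ℂ, ‖t‖ ≤ ε → dist (logDisc e t) 0 < R := fun t ht => by
    have h1 := norm_logDisc_sub_le he (ht.trans hε2)
    have h2 : ‖t.re • e‖ ≤ ‖t‖ := by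
      rw [norm_smul, he, mul_one]; exact Complex.abs_re_le_norm t
    have h3 : ‖logDisc e t‖ ≤ ‖logDisc e t - t.re • e‖ + ‖t.re • e‖ := by
      simpa using norm_add_le (logDisc e t - t.re • e) (t.re • e)
    rw [dist_zero_right]
    nlinarith [norm_nonneg t]
  set w : Cn n := WithLp.toLp 2 fun j => expPt x j * (e j : ℂ) with hw
  have hpt : ∀ s : ℂ, expPt x + s • ((ε : ℂ) • w) = expPt x + ((ε : ℂ) * s) • w := fun s => by
    rw [smul_smul, mul_comm]
  obtain ⟨hint, havg⟩ := hP.2 (expPt x) hx ((ε : ℂ) • w) fun s hs => by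
    rw [hpt, expPt_add_smul_mem_iff hR he ((hsmall s hs).trans hε2)]
    exact (hball (hξ _ (hsmall s hs))).2
  -- The real part of `H` is a harmonic majorant on the unit circle whose value at the centre is too
  -- small. The linear term in `b` is already harmonic, because `log |1 + t e j|` is; the square of
  -- `Re t` is replaced by `(Re (t ^ 2) + ε ^ 2) / 2`, valid on `|t| = ε`.
  set H : ℂ → ℂ := fun s => ∑ j, (b j : ℂ) * Complex.log (1 + ((ε : ℂ) * s) * (e j : ℂ)) -
    (η / 4 : ℝ) * ((ε : ℂ) * s) ^ 2 +
      ((-Real.log (bdryDist D (expPt x)) - (η / 4 * ε ^ 2 - (M + η) * ε ^ 4) : ℝ) : ℂ) with hH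
  have hHd : DiffContOnCl ℂ H (Metric.ball 0 1) := by
    refine DifferentiableOn.diffContOnCl_ball (U := Metric.closedBall 0 1) ?_ subset_rfl
    intro s hs
    refine DifferentiableAt.differentiableWithinAt ?_
    have hs' : ‖s‖ ≤ 1 := by simpa using hs
    refine DifferentiableAt.add (DifferentiableAt.sub (DifferentiableAt.fun_sum fun j _ => ?_)
      (by fun_prop)) (by fun_prop)
    refine DifferentiableAt.const_mul (DifferentiableAt.clog (by fun_prop) ?_) _
    exact one_add_mem_slitPlane (norm_mul_coord_le he ((hsmall s hs').trans hε2) j)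
  obtain ⟨hHi, hHa⟩ := circleAverage_re hHd
  have hle : ∀ s ∈ Metric.sphere (0 : ℂ) |1|,
      -Real.log (bdryDist D (expPt x + s • ((ε : ℂ) • w))) ≤ (H s).re := by
    intro s hs
    have hs1 : ‖s‖ = 1 := by simpa using hs
    have ht : ‖(ε : ℂ) * s‖ = ε := by simp [hs1, abs_of_pos hε]
    rw [hpt, bdryDist_expPt_add_smul hR he (ht.le.trans hε2)]
    refine (hball (hξ _ ht.le)).1.trans ?_
    set t : ℂ := (ε : ℂ) * s with htd
    have h1 := norm_logDisc_sub_le he (ht.le.trans hε2)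
    rw [ht] at h1
    set r := logDisc e t - t.re • e with hr
    have hξr : logDisc e t = t.re • e + r := by rw [hr]; abel
    have hee : inner ℝ e e = 1 := by rw [real_inner_self_eq_norm_sq, he]; norm_num
    have hi : inner ℝ e (logDisc e t) = t.re + inner ℝ e r := by
      rw [hξr, inner_add_right, inner_smul_right, hee, mul_one]
    have hn : ‖logDisc e t‖ ^ 2 = t.re ^ 2 + 2 * t.re * inner ℝ e r + ‖r‖ ^ 2 := by
      rw [hξr, norm_add_sq_real, norm_smul, he, inner_smul_left]
      simp; ring
    have hr2 : ‖r‖ ^ 2 ≤ ε ^ 4 := by nlinarith [norm_nonneg r]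
    have her : (inner ℝ e r) ^ 2 ≤ ε ^ 4 := by
      refine le_trans ?_ hr2
      have := abs_real_inner_le_norm e r
      rw [he, one_mul] at this
      exact sq_le_sq' (by linarith [neg_abs_le (inner ℝ e r)]) ((le_abs_self _).trans this)
    have hre : (t ^ 2).re = 2 * t.re ^ 2 - ε ^ 2 := by
      have : ε ^ 2 = t.re ^ 2 + t.im ^ 2 := by
        rw [← ht, Complex.sq_norm, Complex.normSq_apply]; ring
      rw [this, sq, Complex.mul_re]; ring
    have hHre : (H s).re = inner ℝ b (logDisc e t) - η / 4 * (t ^ 2).re +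
        (-Real.log (bdryDist D (expPt x)) - (η / 4 * ε ^ 2 - (M + η) * ε ^ 4)) := by
      rw [hH]
      simp only [Complex.add_re, Complex.sub_re, Complex.re_sum, Complex.re_ofReal_mul,
        Complex.ofReal_re, Complex.log_re, PiLp.inner_apply, logDisc, htd]
      simp [mul_comm]
    rw [hHre, hi, hn, hre]
    -- With `p = Re t` and `q = ⟨e, r⟩`, the square `(p + 2 * q) ^ 2 ≥ 0` gives `(p + q) ^ 2 ≥ p ^ 2
    -- / 2 - q ^ 2`. The term with `M` reduces to `‖r‖ ^ 2 - q ^ 2`, since the tangential part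
    -- cancels.
    nlinarith [sq_nonneg (t.re + 2 * inner ℝ e r), mul_le_mul_of_nonneg_left hr2 hM.le,
      mul_le_mul_of_nonneg_left her hη.le, mul_nonneg hM.le (sq_nonneg (inner ℝ e r)),
      mul_nonneg hη.le (sq_nonneg (t.re + 2 * inner ℝ e r))]
  have hfin := havg.trans ((Real.circleAverage_mono hint hHi hle).trans_eq hHa)
  have hH0 : (H 0).re = -Real.log (bdryDist D (expPt x)) - (η / 4 * ε ^ 2 - (M + η) * ε ^ 4) := by
    simp only [hH, mul_zero, zero_mul, add_zero, Complex.log_one, Finset.sum_const_zero]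
    simp [-Complex.ofReal_sub, -Complex.ofReal_neg]
  rw [hH0] at hfin
  nlinarith [sq_nonneg ε, pow_pos hε 2]


/-! ### Maximum principle on logarithmic segments. -/

lemma continuousOn_neg_log_bdryDist (hD : IsOpen D) (hf : (frontier D).Nonempty) :
    ContinuousOn (fun x => -Real.log (bdryDist D (expPt x))) (logDomain D) := by
  have h : ContinuousOn (fun x => bdryDist D (expPt x)) (logDomain D) :=
    ((continuous_bdryDist D).comp continuous_expPt).continuousOn
  exact (h.log fun x hx => (bdryDist_pos hD hf hx).ne').neg

lemma isCompact_segment (p q : EuclideanSpace ℝ (Fin n)) : IsCompact (segment ℝ p q) := by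
  rw [segment_eq_image']
  exact isCompact_Icc.image (by fun_prop)

/-- Along a segment in the logarithmic image, the boundary distance is at least its minimum at the
end points. -/
lemma le_bdryDist_of_mem_segment (hD : IsOpen D) (hR : IsReinhardt D) (hP : IsPseudoconvex D)
    (hf : (frontier D).Nonempty) {p q : EuclideanSpace ℝ (Fin n)}
    (hseg : segment ℝ p q ⊆ logDomain D) {c : ℝ} (hc : 0 < c) (hp : c ≤ bdryDist D (expPt p))
    (hq : c ≤ bdryDist D (expPt q)) {r : EuclideanSpace ℝ (Fin n)} (hr : r ∈ segment ℝ p q) :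
    c ≤ bdryDist D (expPt r) := by
  by_contra! hlt
  set v : EuclideanSpace ℝ (Fin n) → ℝ := fun x => -Real.log (bdryDist D (expPt x)) with hv
  have hvc : ContinuousOn v (logDomain D) := continuousOn_neg_log_bdryDist hD hf
  have hΩ : IsOpen (logDomain D) := isOpen_logDomain hD
  have hpΩ := hseg (left_mem_segment ℝ p q)
  have hqΩ := hseg (right_mem_segment ℝ p q)
  have hvp : v p ≤ -Real.log c := neg_le_neg (Real.log_le_log hc hp)
  have hvq : v q ≤ -Real.log c := neg_le_neg (Real.log_le_log hc hq)
  have hvr : -Real.log c < v r :=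
    neg_lt_neg (Real.log_lt_log (bdryDist_pos hD hf (hseg hr)) hlt)
  have hpq : p ≠ q := by
    rintro rfl
    rw [segment_same, mem_singleton_iff] at hr
    exact absurd hp (by rw [← hr]; exact not_le.2 hlt)
  set m := -Real.log c with hm
  set a := v r - m with ha
  have ha0 : 0 < a := sub_pos.2 hvr
  set l := ‖q - p‖ with hl
  have hl0 : 0 < l := norm_pos_iff.2 (sub_ne_zero.2 hpq.symm)
  set e := l⁻¹ • (q - p) with he
  have hle : l • e = q - p := by rw [he, smul_smul, mul_inv_cancel₀ hl0.ne', one_smul]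
  have he1 : ‖e‖ = 1 := by
    rw [he, norm_smul, norm_inv, Real.norm_eq_abs, abs_of_pos hl0, ← hl, inv_mul_cancel₀ hl0.ne']
  have hee : inner ℝ e e = 1 := by rw [real_inner_self_eq_norm_sq, he1]; norm_num
  set s : EuclideanSpace ℝ (Fin n) → ℝ := fun x => inner ℝ e (x - p) with hs
  set g : EuclideanSpace ℝ (Fin n) → ℝ := fun x => ‖x - p‖ ^ 2 - s x ^ 2 with hg
  have hsc : Continuous s := by rw [hs]; fun_prop
  have hgc : Continuous g := by rw [hg]; fun_prop
  have hgeq : ∀ x (σ : ℝ), ‖x - (p + σ • e)‖ ^ 2 = g x + (s x - σ) ^ 2 := by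
    intro x σ
    rw [← sub_sub, norm_sub_sq_real, norm_smul, he1, inner_smul_right, real_inner_comm]
    simp only [hg, hs, Real.norm_eq_abs, mul_one, sq_abs]
    ring
  obtain ⟨δ₁, hδ₁, hth⟩ :=
    (isCompact_segment p q).exists_cthickening_subset_open hΩ hseg
  have hev : ∀ x ∈ logDomain D, v x ≤ m → ∃ δ > 0, ∀ y, ‖y - x‖ < δ → v y < m + a / 3 := by
    intro x hx hxm
    have := (hvc.continuousAt (hΩ.mem_nhds hx)).eventually_lt
      (continuousAt_const (y := m + a / 3)) (by linarith)
    obtain ⟨δ, hδ, h⟩ := Metric.eventually_nhds_iff.1 this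
    exact ⟨δ, hδ, fun y hy => h (by rwa [dist_eq_norm])⟩
  obtain ⟨δ₂, hδ₂, hvp'⟩ := hev p hpΩ hvp
  obtain ⟨δ₃, hδ₃, hvq'⟩ := hev q hqΩ hvq
  obtain ⟨δ, hδ, hδa, hδb, hδc⟩ : ∃ δ > 0, δ < δ₁ ∧ δ < δ₂ ∧ δ < δ₃ := by
    refine ⟨min δ₁ (min δ₂ δ₃) / 2, by positivity, ?_, ?_, ?_⟩
    all_goals
      have h0 : 0 < min δ₁ (min δ₂ δ₃) := by positivity
      have h1 := min_le_left δ₁ (min δ₂ δ₃)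
      have h2 := (min_le_right δ₁ (min δ₂ δ₃)).trans (min_le_left δ₂ δ₃)
      have h3 := (min_le_right δ₁ (min δ₂ δ₃)).trans (min_le_right δ₂ δ₃)
      linarith
  -- A solid cylinder around the segment: `s` is the coordinate along the axis and `g` the squared
  -- distance from the axis.
  set K := {x | 0 ≤ s x ∧ s x ≤ l ∧ g x ≤ δ ^ 2} with hK
  have hKc : IsCompact K := by
    refine Metric.isCompact_of_isClosed_isBounded ?_ ?_
    · exact (isClosed_le continuous_const hsc).inter
        ((isClosed_le hsc continuous_const).inter (isClosed_le hgc continuous_const))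
    · refine (Metric.isBounded_closedBall (x := p) (r := l + δ)).subset fun x hx => ?_
      rw [Metric.mem_closedBall, dist_eq_norm]
      refine abs_le_of_sq_le_sq' ?_ (by positivity) |>.2
      have : ‖x - p‖ ^ 2 = g x + s x ^ 2 := by simp [hg]
      obtain ⟨h1, h2, h3⟩ := hx
      nlinarith
  have hKΩ : K ⊆ logDomain D := by
    intro x hx
    refine hth (Metric.mem_cthickening_of_dist_le x (p + s x • e) δ₁ _ ?_ ?_)
    · rw [segment_eq_image']
      refine ⟨s x / l, ⟨div_nonneg hx.1 hl0.le, (div_le_one hl0).2 hx.2.1⟩, ?_⟩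
      simp only
      rw [← hle, smul_smul, div_mul_cancel₀ _ hl0.ne']
    · rw [dist_eq_norm]
      refine (abs_le_of_sq_le_sq' ?_ hδ.le |>.2).trans hδa.le
      rw [hgeq, sub_self]
      simpa using hx.2.2
  have hrK : r ∈ K ∧ g r = 0 := by
    rw [segment_eq_image'] at hr
    obtain ⟨θ, hθ, rfl⟩ := hr
    have h1 : s (p + θ • (q - p)) = θ * l := by
      simp only [hs, add_sub_cancel_left]
      rw [← hle, smul_smul, inner_smul_right, hee, mul_one]
    have h2 : g (p + θ • (q - p)) = 0 := by
      simp only [hg, h1, add_sub_cancel_left]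
      rw [norm_smul, ← hl, mul_pow, Real.norm_eq_abs, sq_abs]; ring
    refine ⟨⟨?_, ?_, ?_⟩, h2⟩
    · rw [h1]; exact mul_nonneg hθ.1 hl0.le
    · rw [h1]; nlinarith [hθ.2]
    · rw [h2]; positivity
  obtain ⟨y, hyK, hymax⟩ := hKc.exists_isMaxOn ⟨r, hrK.1⟩ (hvc.mono hKΩ)
  -- The perturbation `η * s ^ 2` is at most `a / 3` on `K`, so on the end caps, where `v < m + a /
  -- 3`, the perturbed function stays below its value at `r`, which is at least `m + a`.
  set η := a / (3 * l ^ 2) with hη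
  have hη0 : 0 < η := by positivity
  have hηl : η * l ^ 2 = a / 3 := by rw [hη]; field_simp
  -- Large enough that the penalty `M * g` excludes a maximum on the lateral surface `g = δ ^ 2`;
  -- the maximiser `y` of `v` is needed only for this bound.
  set M := (|v y - v r| + a) / δ ^ 2 with hM
  have hM0 : 0 < M := by positivity
  have hMδ : M * δ ^ 2 = |v y - v r| + a := by rw [hM]; field_simp
  obtain ⟨x, hxK, hxmax⟩ := hKc.exists_isMaxOn (f := fun x => v x + η * s x ^ 2 - M * g x)
    ⟨r, hrK.1⟩ (((hvc.mono hKΩ).add (by fun_prop)).sub (by fun_prop))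
  have hsl : ∀ x ∈ K, η * s x ^ 2 ≤ a / 3 := fun x hx => by
    rw [← hηl]
    have := hx.1
    have := hx.2.1
    gcongr
  have hxr : m + a ≤ v x + η * s x ^ 2 - M * g x := by
    have h : v r + η * s r ^ 2 - M * g r ≤ v x + η * s x ^ 2 - M * g x := hxmax hrK.1
    rw [hrK.2] at h
    have : m + a = v r := by rw [ha]; ring
    nlinarith [mul_nonneg hη0.le (sq_nonneg (s r))]
  have hg0 : ∀ x, 0 ≤ g x := fun x => by
    have := hgeq x (s x)
    rw [sub_self] at this
    nlinarith [sq_nonneg ‖x - (p + s x • e)‖]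
  have hMg : 0 ≤ M * g x := mul_nonneg hM0.le (hg0 x)
  have hsx := hsl x hxK
  obtain ⟨hx1, hx2, hx3⟩ := hxK
  have hs0 : 0 < s x := by
    refine lt_of_le_of_ne hx1 fun h => ?_
    have h1 := hgeq x 0
    rw [← h, zero_smul, add_zero] at h1
    have := hvp' x (lt_of_le_of_lt (abs_le_of_sq_le_sq' (by linarith) hδ.le).2 hδb)
    rw [← h] at hxr
    linarith
  have hsl0 : s x < l := by
    refine lt_of_le_of_ne hx2 fun h => ?_
    have h1 := hgeq x l
    rw [h, hle, add_sub_cancel, sub_self] at h1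
    have := hvq' x (lt_of_le_of_lt (abs_le_of_sq_le_sq' (by linarith) hδ.le).2 hδc)
    linarith
  have hgx : g x < δ ^ 2 := by
    refine lt_of_le_of_ne hx3 fun h => ?_
    rw [h, hMδ] at hxr
    have h1 : v x ≤ v y := hymax ⟨hx1, hx2, hx3⟩
    have h2 := le_abs_self (v y - v r)
    have : m + a = v r := by rw [ha]; ring
    linarith
  -- The maximum is interior, so expanding `s ^ 2` and `g` about `x` bounds `v` from above by a
  -- quadratic strictly concave along `e`; `b` collects the first-order terms.
  refine not_eventually_le_concave hD hR hP (x := x) (e := e)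
    (b := (-(2 * η * s x)) • e + (2 * M) • (x - p) - (2 * M * s x) • e) he1
    (hKΩ ⟨hx1, hx2, hx3⟩) hη0 hM0 ?_
  have hnear : ∀ᶠ ξ in 𝓝 (0 : EuclideanSpace ℝ (Fin n)), x + ξ ∈ K := by
    have hadd : Tendsto (fun ξ => x + ξ) (𝓝 (0 : EuclideanSpace ℝ (Fin n))) (𝓝 x) := by
      simpa using (by fun_prop : Continuous fun ξ => x + ξ).tendsto 0
    refine hadd.eventually ?_
    filter_upwards [hsc.continuousAt.eventually_const_lt hs0,
      hsc.continuousAt.eventually_lt_const hsl0, hgc.continuousAt.eventually_lt_const hgx]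
      with y h1 h2 h3 using ⟨h1.le, h2.le, h3.le⟩
  filter_upwards [hnear] with ξ hξ
  have h : v (x + ξ) + η * s (x + ξ) ^ 2 - M * g (x + ξ) ≤ v x + η * s x ^ 2 - M * g x :=
    hxmax hξ
  have h1 : s (x + ξ) = s x + inner ℝ e ξ := by
    simp only [hs]
    rw [add_sub_right_comm, inner_add_right]
  have h2 : g (x + ξ) = g x + 2 * inner ℝ (x - p) ξ + ‖ξ‖ ^ 2 - 2 * s x * inner ℝ e ξ -
      inner ℝ e ξ ^ 2 := by
    simp only [hg, h1]
    rw [add_sub_right_comm, norm_add_sq_real]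
    ring
  rw [h1, h2] at h
  rw [inner_sub_left, inner_add_left, real_inner_smul_left e, real_inner_smul_left (x - p),
    real_inner_smul_left e]
  change v (x + ξ) ≤ v x + _ + _ - _
  linarith

/-! ### Convexity of the logarithmic image. -/

/-- The set of logarithmic coordinates of points whose moduli are close to those of `z`. -/
def logBox (z : Cn n) (δ : ℝ) : Set (EuclideanSpace ℝ (Fin n)) :=
  {x | ∀ j, |Real.exp (x j) - ‖z j‖| < δ}

lemma convex_logBox (z : Cn n) (δ : ℝ) : Convex ℝ (logBox z δ) := by
  intro x hx y hy a b ha hb hab j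
  have h : Convex ℝ (Real.exp ⁻¹' Ioo (‖z j‖ - δ) (‖z j‖ + δ)) :=
    (ordConnected_Ioo.preimage_mono Real.exp_monotone).convex
  have hm : ∀ u : ℝ, u ∈ Real.exp ⁻¹' Ioo (‖z j‖ - δ) (‖z j‖ + δ) ↔ |Real.exp u - ‖z j‖| < δ := by
    intro u
    rw [abs_sub_lt_iff, mem_preimage, mem_Ioo]
    constructor <;> rintro ⟨h1, h2⟩ <;> constructor <;> linarith
  exact (hm _).1 (h ((hm _).2 (hx j)) ((hm _).2 (hy j)) ha hb hab)

lemma logBox_nonempty (z : Cn n) {δ : ℝ} (hδ : 0 < δ) : (logBox z δ).Nonempty := by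
  -- The shift by `δ / 2` keeps the argument of the logarithm positive when `z j = 0`.
  refine ⟨WithLp.toLp 2 fun j => Real.log (‖z j‖ + δ / 2), fun j => ?_⟩
  have : 0 < ‖z j‖ + δ / 2 := by positivity
  simp only [Real.exp_log this, add_sub_cancel_left]
  rw [abs_of_pos (by positivity)]
  linarith

lemma mem_logBox_expPt (x : EuclideanSpace ℝ (Fin n)) {δ : ℝ} (hδ : 0 < δ) :
    x ∈ logBox (expPt x) δ := fun j => by rw [norm_expPt_apply]; simpa using hδ

lemma logBox_mono (z : Cn n) {δ δ' : ℝ} (h : δ ≤ δ') : logBox z δ ⊆ logBox z δ' :=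
  fun _ hx j => (hx j).trans_le h

/-- Carries open subsets of the logarithmic image back to open sets in `ℂⁿ`, including points with
zero coordinates, which have no logarithm. In this way the connectedness of `D` can be used for its
logarithmic image. -/
lemma isOpen_setOf_logBox_subset (T : Set (EuclideanSpace ℝ (Fin n))) :
    IsOpen {z : Cn n | ∃ δ > 0, logBox z δ ⊆ T} := by
  rw [Metric.isOpen_iff]
  rintro z ⟨δ, hδ, h⟩
  refine ⟨δ / 2, by positivity, fun z' hz' => ⟨δ / 2, by positivity, fun x hx => h fun j => ?_⟩⟩
  have h1 : ‖z' j - z j‖ ≤ ‖z' - z‖ := PiLp.norm_apply_le (z' - z) j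
  have h2 := abs_norm_sub_norm_le (z' j) (z j)
  have h3 := abs_sub_le (Real.exp (x j)) ‖z' j‖ ‖z j‖
  have h4 := hx j
  rw [Metric.mem_ball, dist_eq_norm] at hz'
  linarith

lemma exists_polydisc_subset (hD : IsOpen D) {z : Cn n} (hz : z ∈ D) :
    ∃ δ > 0, ∀ w : Cn n, (∀ j, ‖w j - z j‖ < δ) → w ∈ D := by
  have h : IsOpen ((WithLp.toLp 2 : (Fin n → ℂ) → Cn n) ⁻¹' D) :=
    hD.preimage (PiLp.continuous_toLp 2 _)
  obtain ⟨δ, hδ, hb⟩ := Metric.isOpen_iff.1 h z.ofLp hz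
  refine ⟨δ, hδ, fun w hw => ?_⟩
  have : w.ofLp ∈ Metric.ball z.ofLp δ := by
    rw [Metric.mem_ball, dist_pi_lt_iff hδ]
    simpa only [dist_eq_norm] using hw
  exact hb this

/-- The point whose coordinates are the moduli of those of `z`. -/
def absPt (z : Cn n) : Cn n := WithLp.toLp 2 fun j => (‖z j‖ : ℂ)

lemma norm_absPt_apply (z : Cn n) (j : Fin n) : ‖absPt z j‖ = ‖z j‖ := by simp [absPt]

lemma IsReinhardt.exists_logBox_subset (hR : IsReinhardt D) (hD : IsOpen D) {z : Cn n}
    (hz : z ∈ D) : ∃ δ > 0, logBox z δ ⊆ logDomain D := by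
  obtain ⟨δ, hδ, h⟩ := exists_polydisc_subset hD
    ((hR.mem_iff_of_norm_eq (norm_absPt_apply z)).2 hz)
  refine ⟨δ, hδ, fun x hx => h _ fun j => ?_⟩
  have : expPt x j - absPt z j = ((Real.exp (x j) - ‖z j‖ : ℝ) : ℂ) := by simp [absPt]
  rw [this, Complex.norm_real]
  exact hx j

/-- The logarithmic image of a pseudoconvex Reinhardt domain is convex. -/
lemma convex_logDomain (hD : IsDomainSet D) (hR : IsReinhardt D) (hP : IsPseudoconvex D)
    (hf : (frontier D).Nonempty) : Convex ℝ (logDomain D) := by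
  have hΩ : IsOpen (logDomain D) := isOpen_logDomain hD.1
  rw [convex_iff_segment_subset]
  intro x₀ hx₀
  set G := {x | segment ℝ x₀ x ⊆ logDomain D} with hG
  have hGΩ : G ⊆ logDomain D := fun x hx => hx (right_mem_segment ℝ x₀ x)
  have hGo : IsOpen G := by
    rw [Metric.isOpen_iff]
    intro x hx
    obtain ⟨δ, hδ, hth⟩ := (isCompact_segment x₀ x).exists_cthickening_subset_open hΩ hx
    refine ⟨δ, hδ, fun y hy => ?_⟩
    rintro _ ⟨a, b, ha, hb, hab, rfl⟩
    refine hth (Metric.mem_cthickening_of_dist_le _ (a • x₀ + b • x) δ _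
      ⟨a, b, ha, hb, hab, rfl⟩ ?_)
    rw [dist_add_left, dist_smul₀, Real.norm_eq_abs, abs_of_nonneg hb]
    have := Metric.mem_ball.1 hy
    nlinarith [dist_nonneg (x := y) (y := x)]
  -- `G` is relatively closed: on segments to nearby points of `G`, the boundary distance is at
  -- least a fixed `c > 0` determined by the end points, so the limiting segment cannot touch the
  -- boundary.
  have hGc : ∀ x ∈ logDomain D, x ∈ closure G → x ∈ G := by
    intro x hx hxc
    obtain ⟨c, hc, hc0, hcx⟩ : ∃ c, 0 < c ∧ c ≤ bdryDist D (expPt x₀) ∧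
        c < bdryDist D (expPt x) := by
      have h1 := bdryDist_pos hD.1 hf hx₀
      have h2 := bdryDist_pos hD.1 hf hx
      refine ⟨min (bdryDist D (expPt x₀)) (bdryDist D (expPt x) / 2), by positivity,
        min_le_left _ _, (min_le_right _ _).trans_lt (by linarith)⟩
    have hfr : ∃ᶠ y in 𝓝 x, y ∈ G ∧ c < bdryDist D (expPt y) :=
      (mem_closure_iff_frequently.1 hxc).and_eventually
        (((continuous_bdryDist D).comp continuous_expPt).continuousAt.eventually_const_lt hcx)
    rintro _ ⟨a, b, ha, hb, hab, rfl⟩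
    have hcont : Continuous fun y : EuclideanSpace ℝ (Fin n) => expPt (a • x₀ + b • y) :=
      continuous_expPt.comp (by fun_prop)
    have hz : expPt (a • x₀ + b • x) ∈ closure D ∩ {z | c ≤ bdryDist D z} := by
      have hcl : IsClosed (closure D ∩ {z | c ≤ bdryDist D z}) :=
        isClosed_closure.inter (isClosed_le continuous_const (continuous_bdryDist D))
      refine hcl.mem_of_frequently_of_tendsto (hfr.mono fun y hy => ?_) (hcont.tendsto x)
      have hmem : a • x₀ + b • y ∈ segment ℝ x₀ y := ⟨a, b, ha, hb, hab, rfl⟩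
      exact ⟨subset_closure (hy.1 hmem),
        le_bdryDist_of_mem_segment hD.1 hR hP hf hy.1 hc hc0 hy.2.le hmem⟩
    exact mem_of_mem_closure_of_bdryDist_pos hz.1 (hc.trans_le hz.2)
  set N := logDomain D \ closure G with hN
  have hNo : IsOpen N := hΩ.sdiff isClosed_closure
  have hdis : Disjoint G N := disjoint_left.2 fun x hx hxN => hxN.2 (subset_closure hx)
  have hcov : logDomain D ⊆ G ∪ N := fun x hx => by
    by_cases h : x ∈ closure G
    · exact Or.inl (hGc x hx h)
    · exact Or.inr ⟨hx, h⟩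
  -- A small box is convex, hence lies wholly in `G` or wholly in `N`. This splits `D` into two
  -- disjoint open pieces, and the one belonging to `G` contains `expPt x₀`.
  have hall : D ⊆ {z : Cn n | ∃ δ > 0, logBox z δ ⊆ G} := by
    refine hD.2.isPreconnected.subset_left_of_subset_union (isOpen_setOf_logBox_subset G)
      (isOpen_setOf_logBox_subset N) ?_ ?_ ⟨expPt x₀, hx₀, ?_⟩
    · rw [Set.disjoint_left]
      rintro z ⟨δ, hδ, h⟩ ⟨δ', hδ', h'⟩
      obtain ⟨x, hx⟩ := logBox_nonempty z (lt_min hδ hδ')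
      exact disjoint_left.1 hdis (h (logBox_mono z (min_le_left _ _) hx))
        (h' (logBox_mono z (min_le_right _ _) hx))
    · intro z hz
      obtain ⟨δ, hδ, h⟩ := hR.exists_logBox_subset hD.1 hz
      by_cases hne : (logBox z δ ∩ G).Nonempty
      · exact Or.inl ⟨δ, hδ, (convex_logBox z δ).isPreconnected.subset_left_of_subset_union
          hGo hNo hdis (h.trans hcov) hne⟩
      · refine Or.inr ⟨δ, hδ, fun x hx => (hcov (h hx)).resolve_left fun hxG => hne ⟨x, hx, hxG⟩⟩
    · obtain ⟨δ, hδ, h⟩ := hR.exists_logBox_subset hD.1 hx₀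
      refine ⟨δ, hδ, (convex_logBox _ δ).isPreconnected.subset_left_of_subset_union
          hGo hNo hdis (h.trans hcov) ⟨x₀, mem_logBox_expPt x₀ hδ, ?_⟩⟩
      rw [hG, mem_ofPred_eq, segment_same, singleton_subset_iff]
      exact hx₀
  intro x hx
  obtain ⟨δ, hδ, h⟩ := hall hx
  exact h (mem_logBox_expPt x hδ)

/-- The quantitative form of logarithmic convexity: its lower bound `c` persists when some
coordinates of the points tend to zero. -/
lemma convex_logSublevel (hD : IsDomainSet D) (hR : IsReinhardt D) (hP : IsPseudoconvex D)
    (hf : (frontier D).Nonempty) {c : ℝ} (hc : 0 < c) : Convex ℝ (logSublevel D c) := by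
  have hconv := convex_iff_segment_subset.1 (convex_logDomain hD hR hP hf)
  rw [convex_iff_segment_subset]
  intro x hx y hy z hz
  exact ⟨hconv hx.1 hy.1 hz,
    le_bdryDist_of_mem_segment hD.1 hR hP hf (hconv hx.1 hy.1) hc hx.2 hy.2 hz⟩


/-! ### Points in the interior of the closure. -/

/-- The logarithms of the moduli of the coordinates. -/
def logPt (z : Cn n) : EuclideanSpace ℝ (Fin n) := WithLp.toLp 2 fun j => Real.log ‖z j‖

lemma logPt_expPt (x : EuclideanSpace ℝ (Fin n)) : logPt (expPt x) = x := by
  ext j; simp [logPt, -expPt_apply, norm_expPt_apply]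

lemma norm_expPt_logPt {z : Cn n} {j : Fin n} (hz : z j ≠ 0) : ‖expPt (logPt z) j‖ = ‖z j‖ := by
  rw [norm_expPt_apply]
  exact Real.exp_log (norm_pos_iff.2 hz)

lemma continuousAt_logPt {z : Cn n} (hz : ∀ j, z j ≠ 0) : ContinuousAt (logPt (n := n)) z := by
  refine (PiLp.continuous_toLp 2 _).continuousAt.comp (continuousAt_pi.2 fun j => ?_)
  exact ContinuousAt.log (by fun_prop) (norm_ne_zero_iff.2 (hz j))

lemma expPt_ne_zero (x : EuclideanSpace ℝ (Fin n)) (j : Fin n) : expPt x j ≠ 0 := by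
  rw [← norm_ne_zero_iff, norm_expPt_apply]
  exact (Real.exp_pos _).ne'

lemma IsReinhardt.mem_closure_logDomain (hR : IsReinhardt D) {x : EuclideanSpace ℝ (Fin n)}
    (hx : expPt x ∈ closure D) : x ∈ closure (logDomain D) := by
  have hne : ∀ᶠ z in 𝓝 (expPt x), ∀ j, z j ≠ 0 := by
    rw [eventually_all]
    intro j
    exact (by fun_prop : Continuous fun z : Cn n => z j).continuousAt.eventually_ne
      (expPt_ne_zero x j)
  have hfr : ∃ᶠ z in 𝓝 (expPt x), logPt z ∈ logDomain D :=
    ((mem_closure_iff_frequently.1 hx).and_eventually hne).mono fun z hz =>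
      (hR.mem_iff_of_norm_eq fun j => norm_expPt_logPt (hz.2 j)).2 hz.1
  have ht := continuousAt_logPt (expPt_ne_zero x)
  rw [ContinuousAt, logPt_expPt] at ht
  exact mem_closure_iff_frequently.2 (ht.frequently hfr)

lemma IsReinhardt.logDomain_nonempty (hR : IsReinhardt D) (hD : IsDomainSet D) :
    (logDomain D).Nonempty := by
  obtain ⟨z, hz⟩ := hD.2.nonempty
  obtain ⟨δ, hδ, h⟩ := hR.exists_logBox_subset hD.1 hz
  exact (logBox_nonempty z hδ).mono h

/-- An open convex set equals the interior of its closure, applied to the logarithmic image. -/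
lemma expPt_mem_of_mem_interior_closure (hD : IsDomainSet D) (hR : IsReinhardt D)
    (hP : IsPseudoconvex D) (hf : (frontier D).Nonempty) {x : EuclideanSpace ℝ (Fin n)}
    (hx : expPt x ∈ interior (closure D)) : expPt x ∈ D := by
  have ho := isOpen_logDomain hD.1
  have hint := (convex_logDomain hD hR hP hf).interior_closure_eq_interior_of_nonempty_interior
    (by rw [ho.interior_eq]; exact hR.logDomain_nonempty hD)
  rw [ho.interior_eq] at hint
  have hx' : x ∈ interior (closure (logDomain D)) := by
    refine mem_interior.2 ⟨expPt ⁻¹' interior (closure D), fun y hy => ?_,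
      isOpen_interior.preimage continuous_expPt, hx⟩
    exact hR.mem_closure_logDomain (interior_subset (s := closure D) hy)
  exact hint.le hx'

lemma logSublevel_anti {c c' : ℝ} (h : c ≤ c') : logSublevel D c' ⊆ logSublevel D c :=
  fun _ hx => ⟨hx.1, h.trans hx.2⟩

/-- The indicator vector of a set of coordinates. -/
def indVec (Z : Finset (Fin n)) : EuclideanSpace ℝ (Fin n) :=
  WithLp.toLp 2 fun j => if j ∈ Z then 1 else 0

/-- If `D` meets a coordinate hyperplane, then its logarithmic image contains a ray in the
corresponding direction along which the boundary distance is bounded below. -/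
lemma exists_ray_single (hD : IsDomainSet D) (hR : IsReinhardt D)
    (hf : (frontier D).Nonempty) {p : Cn n} (hp : p ∈ D) {j : Fin n} (hj : p j = 0) :
    ∃ c > 0, ∃ x, ∀ t : ℝ, 0 ≤ t → x - t • indVec {j} ∈ logSublevel D c := by
  set c := bdryDist D p / 2 with hc
  have hp0 := bdryDist_pos hD.1 hf hp
  have ho : IsOpen (D ∩ {z | c < bdryDist D z}) :=
    hD.1.inter (isOpen_lt continuous_const (continuous_bdryDist D))
  have hR' : IsReinhardt (D ∩ {z | c < bdryDist D z}) := by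
    intro t ht z hz
    refine ⟨hR t ht z hz.1, ?_⟩
    have : bdryDist D (WithLp.toLp 2 fun j => t j * z j) = bdryDist D z :=
      hR.bdryDist_eq_of_norm_eq fun j => by simp [ht j]
    exact hz.2.trans_eq this.symm
  obtain ⟨δ, hδ, h⟩ := hR'.exists_logBox_subset ho (z := p) ⟨hp, by simp [hc]; linarith⟩
  obtain ⟨x, hx⟩ := logBox_nonempty p hδ
  refine ⟨c, by positivity, x, fun t ht => ?_⟩
  -- As `p j = 0`, the box bounds the `j`-th coordinate only from above, so it may decrease without
  -- limit.
  have hm : x - t • indVec {j} ∈ logBox p δ := by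
    intro k
    by_cases hk : k = j
    · subst hk
      have hxk := hx k
      rw [hj, norm_zero, sub_zero, abs_of_pos (Real.exp_pos _)] at hxk ⊢
      refine lt_of_le_of_lt (Real.exp_le_exp.2 ?_) hxk
      simpa [indVec] using ht
    · simpa [indVec, hk] using hx k
  exact ⟨(h hm).1, (h hm).2.le⟩

/-- The hyperplanes may be met at different points of `D`. Midpoints of the individual rays merge
their directions by convexity; the parameter `2 * t` compensates for the halving. -/
lemma exists_ray (hD : IsDomainSet D) (hR : IsReinhardt D) (hP : IsPseudoconvex D)
    (hf : (frontier D).Nonempty) (Z : Finset (Fin n)) (hZ : ∀ j ∈ Z, ∃ p ∈ D, p j = 0) :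
    ∃ c > 0, ∃ x, ∀ t : ℝ, 0 ≤ t → x - t • indVec Z ∈ logSublevel D c := by
  induction Z using Finset.induction_on with
  | empty =>
    obtain ⟨x, hx⟩ := hR.logDomain_nonempty hD
    refine ⟨bdryDist D (expPt x), bdryDist_pos hD.1 hf hx, x, fun t _ => ?_⟩
    have : x - t • indVec ∅ = x := by ext j; simp [indVec]
    rw [this]
    exact ⟨hx, le_rfl⟩
  | insert j Z hj ih =>
    obtain ⟨c, hc, x, hx⟩ := ih fun k hk => hZ k (Finset.mem_insert_of_mem hk)
    obtain ⟨p, hp, hpj⟩ := hZ j (Finset.mem_insert_self j Z)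
    obtain ⟨c', hc', x', hx'⟩ := exists_ray_single hD hR hf hp hpj
    refine ⟨min c c', lt_min hc hc', (1 / 2 : ℝ) • x + (1 / 2 : ℝ) • x', fun t ht => ?_⟩
    have h := convex_logSublevel hD hR hP hf (lt_min hc hc')
      (logSublevel_anti (min_le_left c c') (hx (2 * t) (by positivity)))
      (logSublevel_anti (min_le_right c c') (hx' (2 * t) (by positivity)))
      (by norm_num : (0 : ℝ) ≤ 1 / 2) (by norm_num : (0 : ℝ) ≤ 1 / 2) (by norm_num)
    convert h using 1
    ext k
    by_cases hk : k = j
    · subst hk; simp [indVec, hj]; ring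
    · by_cases hkZ : k ∈ Z
      · simp [indVec, hk, hkZ]; ring
      · simp [indVec, hk, hkZ]

lemma IsReinhardt.absPt_mem_interior_closure (hR : IsReinhardt D) {z : Cn n}
    (hz : z ∈ interior (closure D)) : absPt z ∈ interior (closure D) := by
  obtain ⟨t, ht⟩ := exists_rotate_of_norm_eq (norm_absPt_apply z)
  have h := (rotate t).toHomeomorph.preimage_interior (closure D)
  rw [(rotate t).toHomeomorph.preimage_closure] at h
  rw [show (rotate t).toHomeomorph ⁻¹' D = D from hR.preimage_rotate t] at h
  rw [← h]
  change rotate t (absPt z) ∈ interior (closure D)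
  rwa [ht]

/-- A point in the interior of the closure of `D` belongs to `D` unless it lies on a coordinate
hyperplane which does not meet `D`. -/
lemma mem_of_mem_interior_closure (hD : IsDomainSet D) (hR : IsReinhardt D)
    (hP : IsPseudoconvex D) (hf : (frontier D).Nonempty) {z : Cn n}
    (hz : z ∈ interior (closure D)) (h0 : ∀ j, z j = 0 → ∃ p ∈ D, p j = 0) : z ∈ D := by
  rw [← hR.mem_iff_of_norm_eq (norm_absPt_apply z)]
  set Z : Finset (Fin n) := Finset.univ.filter fun j => z j = 0 with hZ
  obtain ⟨c, hc, x, hx⟩ := exists_ray hD hR hP hf Z fun j hj => h0 j (by simpa [hZ] using hj)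
  set y : ℝ → EuclideanSpace ℝ (Fin n) := fun τ =>
    WithLp.toLp 2 fun j => if z j = 0 then -τ else Real.log ‖z j‖ with hy
  have hlim : Tendsto (fun τ => expPt (y τ)) atTop (𝓝 (absPt z)) := by
    refine ((PiLp.continuous_toLp 2 _).tendsto _).comp (tendsto_pi_nhds.2 fun j => ?_)
    refine (Complex.continuous_ofReal.tendsto _).comp ?_
    by_cases hj : z j = 0
    · simpa [hy, hj] using Real.tendsto_exp_neg_atTop_nhds_zero
    · simp [hy, hj, Real.exp_log (norm_pos_iff.2 hj)]
  obtain ⟨τ, hτ⟩ := (hlim.eventually_mem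
    (isOpen_interior.mem_nhds (hR.absPt_mem_interior_closure hz))).exists
  have hyτ : y τ ∈ logDomain D := expPt_mem_of_mem_interior_closure hD hR hP hf hτ
  have hc1 : Continuous fun s : ℝ => y τ + s • (y τ - x) := by fun_prop
  have hev : ∀ᶠ s in 𝓝 (0 : ℝ), y τ + s • (y τ - x) ∈ logDomain D :=
    hc1.continuousAt.eventually_mem ((isOpen_logDomain hD.1).mem_nhds (by simpa using hyτ))
  obtain ⟨s, hs, hs0⟩ := ((hev.filter_mono nhdsWithin_le_nhds).and
    (self_mem_nhdsWithin (s := Ioi (0 : ℝ)) (a := 0))).exists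
  have hs0 : 0 < s := hs0
  -- Pushing slightly past `y τ`, away from `x`, makes `y τ` a proper convex combination of `y'` and
  -- `x`. Sliding `x` down its ray while `y'` stays fixed then produces every later `y t`, with a
  -- common lower bound `c'` for the boundary distance.
  set y' := y τ + s • (y τ - x) with hy'
  have hd' := bdryDist_pos hD.1 hf hs
  set c' := min c (bdryDist D (expPt y')) with hc'
  have hc'0 : 0 < c' := lt_min hc hd'
  have hmem : ∀ t : ℝ, τ ≤ t → y t ∈ logSublevel D c' := by
    intro t ht
    have h1 : y' ∈ logSublevel D c' := ⟨hs, min_le_right _ _⟩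
    have h2 := logSublevel_anti (min_le_left c (bdryDist D (expPt y')))
      (hx ((t - τ) * (1 + s) / s) (div_nonneg (mul_nonneg (by linarith) (by positivity)) hs0.le))
    have h3 := convex_logSublevel hD hR hP hf hc'0 h1 h2 (a := 1 / (1 + s)) (b := s / (1 + s))
      (by positivity) (by positivity) (by field_simp)
    convert h3 using 1
    ext j
    by_cases hj : z j = 0
    · simp [hy', hy, hj, indVec, hZ]; field_simp; ring
    · simp [hy', hy, hj, indVec, hZ]; field_simp; ring
  have hcl : IsClosed (closure D ∩ {z | c' ≤ bdryDist D z}) :=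
    isClosed_closure.inter (isClosed_le continuous_const (continuous_bdryDist D))
  have hfin := hcl.mem_of_tendsto hlim ((eventually_ge_atTop τ).mono fun t ht =>
    ⟨subset_closure (hmem t ht).1, (hmem t ht).2⟩)
  exact mem_of_mem_closure_of_bdryDist_pos hfin.1 (hc'0.trans_le hfin.2)


/-! ### Upper bounds for the Kobayashi distance. -/

lemma kobayashi_le_lempert (hD : IsDomainSet D) {w z : Cn n} (hw : w ∈ D) (hz : z ∈ D) :
    kobayashi D w z ≤ lempert D w z :=
  iSup₂_le fun _ hd => hd.le_lempert n D hD w hw z hz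

lemma kobayashi_triangle (hD : IsDomainSet D) {w x z : Cn n} (hw : w ∈ D) (hx : x ∈ D)
    (hz : z ∈ D) : kobayashi D w z ≤ kobayashi D w x + kobayashi D x z := by
  refine iSup₂_le fun d hd => ?_
  refine (ENNReal.ofReal_le_ofReal ((hd.pseudodist n D hD).triangle w hw x hx z hz)).trans ?_
  refine ENNReal.ofReal_add_le.trans (add_le_add ?_ ?_)
  · exact le_iSup₂ (f := fun (d : DistFamily) (_ : IsAdmissible d) => ENNReal.ofReal (d n D w x))
      d hd
  · exact le_iSup₂ (f := fun (d : DistFamily) (_ : IsAdmissible d) => ENNReal.ofReal (d n D x z))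
      d hd

lemma kobayashi_symm (hD : IsDomainSet D) {w z : Cn n} (hw : w ∈ D) (hz : z ∈ D) :
    kobayashi D w z = kobayashi D z w :=
  iSup_congr fun d => iSup_congr fun hd => by rw [(hd.pseudodist n D hD).symm w hw z hz]

lemma kobayashi_self (hD : IsDomainSet D) {z : Cn n} (hz : z ∈ D) : kobayashi D z z = 0 := by
  refine le_antisymm (iSup₂_le fun d hd => ?_) zero_le
  rw [(hd.pseudodist n D hD).self z hz, ENNReal.ofReal_zero]

lemma lempert_le_of_disc {f : ℂ → Cn n} (hf : DifferentiableOn ℂ f (Metric.ball 0 1))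
    (hm : MapsTo f (Metric.ball 0 1) D) {a b : ℂ} (ha : a ∈ Metric.ball (0 : ℂ) 1)
    (hb : b ∈ Metric.ball (0 : ℂ) 1) :
    lempert D (f a) (f b) ≤ ENNReal.ofReal (poincareDist a b) :=
  iInf_le_of_le f (iInf_le_of_le a (iInf_le_of_le b (iInf_le_of_le ⟨hf, hm, ha, hb, rfl, rfl⟩
    le_rfl)))

/-- The Kobayashi distance from the centre is uniformly bounded on half of a ball in `D`. -/
lemma kobayashi_le_of_mem_ball (hD : IsDomainSet D) {x z : Cn n} {R : ℝ}
    (hb : Metric.ball x R ⊆ D) (hz : dist z x < R / 2) :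
    kobayashi D x z ≤ ENNReal.ofReal (poincareDist 0 (1 / 2)) := by
  have hR : 0 < R := by linarith [dist_nonneg (x := z) (y := x)]
  have hm : MapsTo (fun t : ℂ => x + t • ((2 : ℂ) • (z - x))) (Metric.ball 0 1) D := by
    intro t ht
    apply hb
    rw [dist_eq_norm] at hz
    rw [Metric.mem_ball, dist_eq_norm, add_sub_cancel_left, norm_smul, norm_smul]
    have : ‖t‖ < 1 := by simpa using ht
    simp only [Complex.norm_ofNat]
    nlinarith [norm_nonneg t, norm_nonneg (z - x)]
  have h := lempert_le_of_disc (f := fun t : ℂ => x + t • ((2 : ℂ) • (z - x)))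
    (a := 0) (b := 1 / 2) (by fun_prop) hm (by simp) (by simp; norm_num)
  have h0 : x + (0 : ℂ) • ((2 : ℂ) • (z - x)) = x := by simp
  have h1 : x + (1 / 2 : ℂ) • ((2 : ℂ) • (z - x)) = z := by rw [smul_smul]; norm_num
  simp only [h0, h1] at h
  have hzD : z ∈ D := hb (by rw [Metric.mem_ball]; linarith)
  exact (kobayashi_le_lempert hD (hb (Metric.mem_ball_self hR)) hzD).trans h

/-- Local finiteness on balls and the triangle inequality make both the set of finite and the set of
infinite distance open, so connectedness excludes the latter. -/
lemma kobayashi_ne_top (hD : IsDomainSet D) {x z : Cn n} (hx : x ∈ D) (hz : z ∈ D) :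
    kobayashi D x z ≠ ⊤ := by
  set S := {z | z ∈ D ∧ kobayashi D x z ≠ ⊤} with hS
  set T := {z | z ∈ D ∧ kobayashi D x z = ⊤} with hT
  have hloc : ∀ y ∈ D, ∃ R > 0, Metric.ball y R ⊆ D ∧
      ∀ w ∈ Metric.ball y R, kobayashi D y w ≠ ⊤ := by
    intro y hy
    obtain ⟨R, hR, hb⟩ := Metric.isOpen_iff.1 hD.1 y hy
    refine ⟨R / 2, by positivity, (Metric.ball_subset_ball (by linarith)).trans hb, fun w hw => ?_⟩
    exact ne_top_of_le_ne_top ENNReal.ofReal_ne_top (kobayashi_le_of_mem_ball hD hb hw)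
  have hSo : IsOpen S := by
    rw [Metric.isOpen_iff]
    intro y hy
    obtain ⟨R, hR, hb, h⟩ := hloc y hy.1
    exact ⟨R, hR, fun w hw => ⟨hb hw, ne_top_of_le_ne_top (ENNReal.add_ne_top.2 ⟨hy.2, h w hw⟩)
      (kobayashi_triangle hD hx hy.1 (hb hw))⟩⟩
  have hTo : IsOpen T := by
    rw [Metric.isOpen_iff]
    intro y hy
    obtain ⟨R, hR, hb, h⟩ := hloc y hy.1
    refine ⟨R, hR, fun w hw => ⟨hb hw, ?_⟩⟩
    by_contra hne
    refine ne_top_of_le_ne_top (ENNReal.add_ne_top.2 ⟨hne, ?_⟩)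
      (kobayashi_triangle hD hx (hb hw) hy.1) hy.2
    rw [kobayashi_symm hD (hb hw) hy.1]
    exact h w hw
  have hsub : D ⊆ S := hD.2.isPreconnected.subset_left_of_subset_union hSo hTo
    (disjoint_left.2 fun z hz hz' => hz.2 hz'.2)
    (fun z hz => by
      by_cases h : kobayashi D x z = ⊤
      · exact Or.inr ⟨hz, h⟩
      · exact Or.inl ⟨hz, h⟩)
    ⟨x, hx, hx, by rw [kobayashi_self hD hx]; exact ENNReal.zero_ne_top⟩
  exact (hsub hz).2

/-- The Kobayashi distance from a fixed point is bounded on compact sets. -/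
lemma exists_kobayashi_le_of_isCompact (hD : IsDomainSet D) {x : Cn n} (hx : x ∈ D)
    {K : Set (Cn n)} (hK : IsCompact K) (hKD : K ⊆ D) :
    ∃ C : ℝ, 0 ≤ C ∧ ∀ z ∈ K, kobayashi D x z ≤ ENNReal.ofReal C := by
  have hloc : ∀ y ∈ K, ∃ t ∈ 𝓝[K] y, ∃ C : ℝ, 0 ≤ C ∧ ∀ z ∈ t,
      kobayashi D x z ≤ ENNReal.ofReal C := by
    intro y hy
    obtain ⟨R, hR, hb⟩ := Metric.isOpen_iff.1 hD.1 y (hKD hy)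
    have hlt := kobayashi_ne_top hD hx (hKD hy)
    refine ⟨Metric.ball y (R / 2), mem_nhdsWithin_of_mem_nhds
      (Metric.ball_mem_nhds y (by positivity)),
      (kobayashi D x y + ENNReal.ofReal (poincareDist 0 (1 / 2))).toReal,
      ENNReal.toReal_nonneg, fun z hz => ?_⟩
    rw [ENNReal.ofReal_toReal (ENNReal.add_ne_top.2 ⟨hlt, ENNReal.ofReal_ne_top⟩)]
    have hzD : z ∈ D := hb (Metric.ball_subset_ball (by linarith) hz)
    exact (kobayashi_triangle hD hx (hKD hy) hzD).trans
      (add_le_add_right (kobayashi_le_of_mem_ball hD hb hz) _)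
  refine hK.induction_on (p := fun t => ∃ C : ℝ, 0 ≤ C ∧ ∀ z ∈ t,
      kobayashi D x z ≤ ENNReal.ofReal C) ⟨0, le_rfl, by simp⟩ ?_ ?_ hloc
  · rintro s t hst ⟨C, hC, h⟩
    exact ⟨C, hC, fun z hz => h z (hst hz)⟩
  · rintro s t ⟨C, hC, h⟩ ⟨C', hC', h'⟩
    refine ⟨max C C', le_max_of_le_left hC, fun z hz => ?_⟩
    rcases hz with hz | hz
    · exact (h z hz).trans (ENNReal.ofReal_le_ofReal (le_max_left _ _))
    · exact (h' z hz).trans (ENNReal.ofReal_le_ofReal (le_max_right _ _))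

lemma poincareDist_zero_cayley {X : ℝ} (hX : 1 < X) :
    poincareDist 0 (((X - 1) / (X + 1) : ℝ) : ℂ) = 1 / 2 * Real.log X := by
  have h1 : 0 < X - 1 := by linarith
  have h2 : 0 < X + 1 := by linarith
  unfold poincareDist
  simp only [map_zero, zero_mul, sub_zero, div_one, zero_sub, norm_neg, Complex.norm_real,
    Real.norm_eq_abs]
  rw [abs_of_pos (by positivity)]
  congr 2
  field_simp
  ring

/-- The Cayley transform maps the disc to the right half plane. -/
lemma re_cayley_pos {t : ℂ} (ht : ‖t‖ < 1) : 0 < ((1 + t) / (1 - t)).re := by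
  have hne : (1 - t) ≠ 0 := by
    intro h
    rw [← sub_eq_zero.1 h] at ht
    simp at ht
  rw [Complex.div_re, ← add_div]
  refine div_pos ?_ (Complex.normSq_pos.2 hne)
  have h : t.re * t.re + t.im * t.im < 1 := by
    rw [← Complex.normSq_apply, Complex.normSq_eq_norm_sq]
    nlinarith [norm_nonneg t]
  simp
  nlinarith


/-! ### Discs winding around the missing hyperplanes. -/

lemma isCompact_polyannulus (ζ : Cn n) (I : Finset (Fin n)) (ρ σ : ℝ) :
    IsCompact {w : Cn n | (∀ j, ‖w j - ζ j‖ ≤ ρ) ∧ ∀ j ∈ I, σ ≤ ‖w j‖} := by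
  have hc : IsCompact ((WithLp.toLp 2 : (Fin n → ℂ) → Cn n) ''
      Set.pi univ fun j => Metric.closedBall (ζ j) ρ) :=
    (isCompact_univ_pi fun j => isCompact_closedBall _ _).image (PiLp.continuous_toLp 2 _)
  refine hc.of_isClosed_subset ?_ fun w hw => ⟨w.ofLp, fun j _ => ?_, rfl⟩
  · refine IsClosed.and ?_ ?_
    · simp only [ofPred_forall]
      exact isClosed_iInter fun j => isClosed_le (by fun_prop) continuous_const
    · simp only [ofPred_forall]
      exact isClosed_iInter fun j => isClosed_iInter fun _ =>
        isClosed_le continuous_const (by fun_prop)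
  · rw [mem_closedBall_iff_norm]
    exact hw.1 j

/-- If `D` misses a coordinate hyperplane, the boundary distance is at most the distance to it. -/
lemma bdryDist_le_norm_apply (hD : IsOpen D) {z : Cn n} (hz : z ∈ D) {j : Fin n}
    (hj : ∀ p ∈ D, p j ≠ 0) : bdryDist D z ≤ ‖z j‖ := by
  have h := bdryDist_le_dist hD hz (w := z - EuclideanSpace.single j (z j))
    fun h => hj _ h (by simp)
  rwa [dist_eq_norm, sub_sub_cancel, PiLp.norm_single] at h

/-- The disc which joins `z` to a polyannulus: in the coordinates of `I` it is the exponential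
covering of a punctured disc of radius `ρ`, in the others it is constant. -/
def coveringDisc (I : Finset (Fin n)) (ρ : ℝ) (z : Cn n) (β : Fin n → ℝ) (X : ℝ) (t : ℂ) : Cn n :=
  WithLp.toLp 2 fun j => if j ∈ I then
    (ρ : ℂ) * Complex.exp (Complex.log (z j / ρ) - β j * ((1 + t) / (1 - t) - X)) else z j

lemma coveringDisc_apply_of_mem {I : Finset (Fin n)} {j : Fin n} (hj : j ∈ I) (ρ : ℝ) (z : Cn n)
    (β : Fin n → ℝ) (X : ℝ) (t : ℂ) : coveringDisc I ρ z β X t j =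
      (ρ : ℂ) * Complex.exp (Complex.log (z j / ρ) - β j * ((1 + t) / (1 - t) - X)) := by
  simp [coveringDisc, hj]

lemma coveringDisc_apply_of_notMem {I : Finset (Fin n)} {j : Fin n} (hj : j ∉ I) (ρ : ℝ)
    (z : Cn n) (β : Fin n → ℝ) (X : ℝ) (t : ℂ) : coveringDisc I ρ z β X t j = z j := by
  simp [coveringDisc, hj]

lemma norm_coveringDisc_apply {I : Finset (Fin n)} {j : Fin n} (hj : j ∈ I) {ρ : ℝ} (hρ : 0 < ρ)
    (z : Cn n) (β : Fin n → ℝ) (X : ℝ) (t : ℂ) : ‖coveringDisc I ρ z β X t j‖ =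
      ρ * Real.exp (Real.log (‖z j‖ / ρ) - β j * (((1 + t) / (1 - t)).re - X)) := by
  rw [coveringDisc_apply_of_mem hj, norm_mul, Complex.norm_exp, Complex.norm_real,
    Real.norm_eq_abs, abs_of_pos hρ, Complex.sub_re, Complex.log_re, norm_div, Complex.norm_real,
    Real.norm_eq_abs, abs_of_pos hρ, Complex.re_ofReal_mul, Complex.sub_re, Complex.ofReal_re]

lemma differentiableOn_coveringDisc (I : Finset (Fin n)) (ρ : ℝ) (z : Cn n) (β : Fin n → ℝ)
    (X : ℝ) : DifferentiableOn ℂ (coveringDisc I ρ z β X) (Metric.ball 0 1) := by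
  rw [differentiableOn_euclidean]
  intro j
  by_cases hj : j ∈ I
  · simp only [coveringDisc_apply_of_mem hj]
    refine DifferentiableOn.const_mul (DifferentiableOn.cexp ?_) _
    refine (differentiableOn_const _).sub (DifferentiableOn.const_mul ?_ _)
    refine DifferentiableOn.sub_const (DifferentiableOn.div (by fun_prop) (by fun_prop) ?_) _
    intro t ht h
    rw [← sub_eq_zero.1 h] at ht
    simp at ht
  · simp only [coveringDisc_apply_of_notMem hj]
    exact differentiableOn_const _

end KobReinhardt

end

/-! ### The estimate near the boundary point. -/

open KobReinhardt in
theorem theorem2 (n : ℕ) (D : Set (KobReinhardt.Cn n))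
    (hD : KobReinhardt.IsDomainSet D) (hR : KobReinhardt.IsReinhardt D)
    (hP : KobReinhardt.IsPseudoconvex D)
    (z₀ : KobReinhardt.Cn n) (hz₀ : z₀ ∈ D)
    (ζ₀ : KobReinhardt.Cn n) (hζ₀ : ζ₀ ∈ frontier D ∩ interior (closure D)) :
    ∃ C : ℝ, ∀ᶠ z in 𝓝[D] ζ₀,
      (KobReinhardt.kobayashi D z₀ z : EReal) ≤
        (((1 / 2 : ℝ) * Real.log (-Real.log (KobReinhardt.bdryDist D z)) + C : ℝ) : EReal) := by
  classical
  obtain ⟨hζf, hζi⟩ := hζ₀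
  have hf : (frontier D).Nonempty := ⟨ζ₀, hζf⟩
  have hζD : ζ₀ ∉ D := by
    rw [hD.1.frontier_eq] at hζf
    exact hζf.2
  set I : Finset (Fin n) := Finset.univ.filter fun j => ζ₀ j = 0 ∧ ∀ p ∈ D, p j ≠ 0 with hI
  have hIζ : ∀ j ∈ I, ζ₀ j = 0 := fun j hj => (Finset.mem_filter.1 hj).2.1
  have hID : ∀ j ∈ I, ∀ p ∈ D, p j ≠ 0 := fun j hj => (Finset.mem_filter.1 hj).2.2
  have hIne : I.Nonempty := by
    by_contra hne
    refine hζD (mem_of_mem_interior_closure hD hR hP hf hζi fun j hj => ?_)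
    by_contra! hno
    exact hne ⟨j, by simpa [hI] using ⟨hj, hno⟩⟩
  obtain ⟨δ, hδ, hpoly⟩ : ∃ δ > 0, ∀ w : Cn n, (∀ j, ‖w j - ζ₀ j‖ < δ) →
      w ∈ interior (closure D) ∩ ⋂ j : Fin n, {w : Cn n | ζ₀ j ≠ 0 → w j ≠ 0} := by
    refine exists_polydisc_subset (isOpen_interior.inter (isOpen_iInter_of_finite fun j => ?_))
      ⟨hζi, mem_iInter.2 fun j h => h⟩
    by_cases hj : ζ₀ j = 0
    · simp [hj]
    · simpa [hj] using isOpen_ne_fun (by fun_prop : Continuous fun w : Cn n => w j)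
        continuous_const
  -- Coordinates nonzero at `ζ₀` stay nonzero on the polydisc, so the only hyperplanes that can
  -- obstruct membership are those indexed by `I`.
  have hmem : ∀ w : Cn n, (∀ j, ‖w j - ζ₀ j‖ < δ) → (∀ j ∈ I, w j ≠ 0) → w ∈ D := by
    intro w hw hwI
    obtain ⟨h1, h2⟩ := hpoly w hw
    refine mem_of_mem_interior_closure hD hR hP hf h1 fun j hj => ?_
    have hζj : ζ₀ j = 0 := by
      by_contra hne
      exact mem_iInter.1 h2 j hne hj
    by_contra! hno
    exact hwI j (by simpa [hI] using ⟨hζj, hno⟩) hj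
  obtain ⟨ρ, hρ, hρ1, hρδ⟩ : ∃ ρ > 0, ρ ≤ 1 ∧ ρ < δ :=
    ⟨min 1 (δ / 2), by positivity, min_le_left _ _, (min_le_right _ _).trans_lt (by linarith)⟩
  set K : Set (Cn n) :=
    {w | (∀ j, ‖w j - ζ₀ j‖ ≤ ρ) ∧ ∀ j ∈ I, ρ * Real.exp (-1) ≤ ‖w j‖} with hK
  have hKD : K ⊆ D := fun w hw => hmem w (fun j => (hw.1 j).trans_lt hρδ) fun j hj =>
    norm_pos_iff.1 ((by positivity : (0 : ℝ) < ρ * Real.exp (-1)).trans_le (hw.2 j hj))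
  obtain ⟨C, hC, hCK⟩ := exists_kobayashi_le_of_isCompact hD hz₀
    (isCompact_polyannulus ζ₀ I ρ (ρ * Real.exp (-1))) hKD
  refine ⟨C, ?_⟩
  -- The factor `exp (-2)` forces every `x j` with `j ∈ I` above `2`, which makes `X - 1` and all
  -- the speeds `β j` positive.
  have hnear : ∀ᶠ z in 𝓝 ζ₀, ∀ j, ‖z j - ζ₀ j‖ < ρ * Real.exp (-2) := by
    rw [eventually_all]
    intro j
    refine (by fun_prop : Continuous fun z : Cn n => ‖z j - ζ₀ j‖).continuousAt.eventually_lt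
      continuousAt_const ?_
    rw [sub_self, norm_zero]
    positivity
  filter_upwards [nhdsWithin_le_nhds hnear, self_mem_nhdsWithin] with z hz hzD
  have he2 : ρ * Real.exp (-2) < ρ := by
    have : Real.exp (-2) < 1 := Real.exp_lt_one_iff.2 (by norm_num)
    nlinarith
  set x : Fin n → ℝ := fun j => -Real.log (‖z j‖ / ρ) with hx
  have hzpos : ∀ j ∈ I, 0 < ‖z j‖ := fun j hj => norm_pos_iff.2 (hID j hj z hzD)
  have hx2 : ∀ j ∈ I, 2 < x j := fun j hj => by
    have h1 := hz j
    rw [hIζ j hj, sub_zero] at h1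
    have h2 : ‖z j‖ / ρ < Real.exp (-2) := by rwa [div_lt_iff₀ hρ, mul_comm]
    have h3 := (Real.log_lt_iff_lt_exp (div_pos (hzpos j hj) hρ)).2 h2
    simp only [hx]
    linarith
  obtain ⟨k, hk, hkmax⟩ := I.exists_max_image x hIne
  set X := x k with hX
  have hX2 : 2 < X := hx2 k hk
  have hX1 : 0 < X - 1 := by linarith
  -- In the half-plane coordinate `ω = (1 + t) / (1 - t)`, the `j`-th modulus is `ρ * exp (-(1 + β j
  -- * (Re ω - 1)))` for `j ∈ I`. The speed is chosen so that `ω = X` gives `z j` and `ω = 1`, the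
  -- centre of the disc, gives modulus `ρ * exp (-1)`. Maximality of `X` yields `β j ≤ 1`, so the
  -- modulus stays below `ρ` whenever `Re ω > 0`.
  set β : Fin n → ℝ := fun j => (x j - 1) / (X - 1) with hβ
  have hβX : ∀ j, β j * (X - 1) = x j - 1 := fun j => div_mul_cancel₀ _ hX1.ne'
  have hβ0 : ∀ j ∈ I, 0 < β j := fun j hj => div_pos (by linarith [hx2 j hj]) hX1
  have hβ1 : ∀ j ∈ I, β j ≤ 1 := fun j hj => (div_le_one hX1).2 (by linarith [hkmax j hj])
  set f := coveringDisc I ρ z β X with hfdef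
  have hfD : MapsTo f (Metric.ball 0 1) D := by
    intro t ht
    have hre := re_cayley_pos (t := t) (by simpa using ht)
    refine hmem _ (fun j => ?_) fun j hj => ?_
    · by_cases hj : j ∈ I
      · rw [hIζ j hj, sub_zero, norm_coveringDisc_apply hj hρ]
        refine lt_trans ?_ hρδ
        refine mul_lt_of_lt_one_right hρ (Real.exp_lt_one_iff.2 ?_)
        have h1 : Real.log (‖z j‖ / ρ) = -x j := by simp [hx]
        rw [h1]
        nlinarith [hβX j, hβ1 j hj, mul_pos (hβ0 j hj) hre]
      · rw [coveringDisc_apply_of_notMem hj]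
        exact (hz j).trans (he2.trans hρδ)
    · rw [coveringDisc_apply_of_mem hj]
      exact mul_ne_zero (Complex.ofReal_ne_zero.2 hρ.ne') (Complex.exp_ne_zero _)
  have hf0 : f 0 ∈ K := by
    have hn : ∀ j ∈ I, ‖f 0 j‖ = ρ * Real.exp (-1) := fun j hj => by
      rw [norm_coveringDisc_apply hj hρ]
      have h1 : Real.log (‖z j‖ / ρ) = -x j := by simp [hx]
      have h2 : ((1 + 0 : ℂ) / (1 - 0)).re = 1 := by simp
      rw [h1, h2]
      congr 2
      linarith [hβX j]
    refine ⟨fun j => ?_, fun j hj => (hn j hj).ge⟩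
    by_cases hj : j ∈ I
    · rw [hIζ j hj, sub_zero, hn j hj]
      exact mul_le_of_le_one_right hρ.le (Real.exp_le_one_iff.2 (by norm_num))
    · rw [coveringDisc_apply_of_notMem hj]
      exact ((hz j).trans he2).le
  -- The preimage of `X` under the Cayley transform.
  set b : ℂ := (((X - 1) / (X + 1) : ℝ) : ℂ) with hb
  have hXp : 0 < X + 1 := by linarith
  have hbmem : b ∈ Metric.ball (0 : ℂ) 1 := by
    rw [mem_ball_zero_iff, hb, Complex.norm_real, Real.norm_eq_abs, abs_of_pos (by positivity),
      div_lt_one hXp]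
    linarith
  have hfb : f b = z := by
    have hcay : (1 + b) / (1 - b) = X := by
      rw [hb, ← Complex.ofReal_one, ← Complex.ofReal_add, ← Complex.ofReal_sub,
        ← Complex.ofReal_div]
      congr 1
      field_simp
      ring
    ext j
    by_cases hj : j ∈ I
    · rw [coveringDisc_apply_of_mem hj, hcay, sub_self, mul_zero, sub_zero, Complex.exp_log,
        mul_div_cancel₀]
      · exact Complex.ofReal_ne_zero.2 hρ.ne'
      · exact div_ne_zero (hID j hj z hzD) (Complex.ofReal_ne_zero.2 hρ.ne')
    · rw [coveringDisc_apply_of_notMem hj]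
  have hkob : kobayashi D (f 0) z ≤ ENNReal.ofReal (1 / 2 * Real.log X) := by
    have h := lempert_le_of_disc (differentiableOn_coveringDisc I ρ z β X) hfD
      (Metric.mem_ball_self one_pos) hbmem
    rw [poincareDist_zero_cayley (by linarith)] at h
    change lempert D (f 0) (f b) ≤ _ at h
    rw [hfb] at h
    exact (kobayashi_le_lempert hD (hKD hf0) hzD).trans h
  have hlogX : 0 ≤ Real.log X := Real.log_nonneg (by linarith)
  have htot : kobayashi D z₀ z ≤ ENNReal.ofReal (1 / 2 * Real.log X + C) := by
    refine (kobayashi_triangle hD hz₀ (hKD hf0) hzD).trans ?_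
    rw [add_comm, ENNReal.ofReal_add (by positivity) hC]
    exact add_le_add hkob (hCK _ hf0)
  -- The hyperplane indexed by the maximising `k` misses `D`, which bounds the boundary distance by
  -- `‖z k‖`; `ρ ≤ 1` allows `log ρ` to be dropped.
  have hXd : X ≤ -Real.log (bdryDist D z) := by
    have h1 := Real.log_le_log (bdryDist_pos hD.1 hf hzD)
      (bdryDist_le_norm_apply hD.1 hzD (hID k hk))
    have h2 : X = Real.log ρ - Real.log ‖z k‖ := by
      simp only [hX, hx]
      rw [Real.log_div (hzpos k hk).ne' hρ.ne']
      ring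
    linarith [Real.log_nonpos hρ.le hρ1]
  refine (EReal.coe_ennreal_le_coe_ennreal_iff.2 htot).trans ?_
  rw [EReal.coe_ennreal_ofReal, max_eq_left (by positivity), EReal.coe_le_coe_iff]
  linarith [Real.log_le_log (by linarith) hXd]
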